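/- For $N\in\mathbb N$ let $\mathscr H_N=(\mathscr V_N,\mathscr E_N)$ be the $N$-cube: $\mathscr V_N=\{0,1\}^N$, and two vertices are adjacent iff they differ in exactly one coordinate. Independent bond percolation on $\mathscr H_N$ with parameter $\beta$ keeps all vertices and keeps each edge independently with probability $\beta$ (the edge is then open, otherwise closed). A vertex is isolated in a graph if its degree is $0$. Events $A_N$ happen with high probability (WHP) if $\lim_{N\to\infty}\mathsf P(A_N)=1$. Let $\beta=1/2$. (i) If, for every $N$, $\mathscr B_N$ is an independent bond percolation on $\mathscr H_N$ with parameter $\beta$, then WHP $\mathscr B_N$ has a unique largest connected component, and the vertices outside this component are exactly the isolated vertices of $\mathscr B_N$. (ii) The same holds for the following percolation $\mathscr B^{*}_N$ coupled with a random game. Let $\mu$ be a probability law on $\mathbb R$ with $\mathsf P(Z_1<Z_2)=\beta=1/2$ for $Z_1,Z_2$ i.i.d. with law $\mu$; for every $N$ let $(Z_i^{s})_{1\le i\le N,\,s\in\mathscr V_N}$ be i.i.d. with law $\mu$, let $\mathscr B_1$ be an independent bond percolation on $\mathscr H_N$ with parameter $\beta$ that is independent of the family $(Z_i^s)$, and let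 $a_N\in\mathscr V_N$. If $s,t$ differ exactly in coordinate $i$, write $s\to t$ when $Z_i^{s}<Z_i^{t}$. Put $\mathscr P_1=\{a_N\}$ and $\mathscr P_{k+1}=\mathscr P_k\cup\{w\notin\mathscr P_k: u\to w\text{ for some }u\in\mathscr P_k\}$. The graph $\mathscr B_{k+1}$ is obtained from $\mathscr B_k$ by redeclaring each edge $[u,w]\in\mathscr E_N$ with $u\in\mathscr P_k$, $w\notin\mathscr P_k$ to be open if $u\to w$ and closed otherwise; all other edges keep their status. Let $\mathscr B^{*}_N=\mathscr B_{2^N}$. Then WHP $\mathscr B^{*}_N$ has a unique largest connected component, and the vertices outside this component are exactly the isolated vertices of $\mathscr B^{*}_N$. -/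

import Mathlib

open MeasureTheory ProbabilityTheory Filter Topology

namespace NCube

/-- Action profiles of `N` players with two actions each: the vertices of the `N`-cube. -/
abbrev Profile (N : ℕ) : Type := Fin N → Bool

/-- `s ∼ᵢ t`: the profiles differ in coordinate `i` and in no other coordinate. -/
def NeighborsAt {N : ℕ} (i : Fin N) (s t : Profile N) : Prop :=
  s i ≠ t i ∧ ∀ j, j ≠ i → s j = t j

lemma NeighborsAt.symm {N : ℕ} {i : Fin N} {s t : Profile N} (h : NeighborsAt i s t) :
    NeighborsAt i t s :=
  ⟨h.1.symm, fun j hj => (h.2 j hj).symm⟩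

/-- The `N`-cube: two profiles are adjacent iff they differ in exactly one coordinate. -/
def cube (N : ℕ) : SimpleGraph (Profile N) where
  Adj s t := ∃ i, NeighborsAt i s t
  symm := ⟨fun _ _ ⟨i, h⟩ => ⟨i, h.symm⟩⟩
  loopless := ⟨fun _ ⟨_, h⟩ => h.1 rfl⟩

/-- The random graph `X` is an independent bond percolation on `G` with parameter `p`: every edge of
`G` is open (kept) with probability `p`, independently over the edges, and `X` has all vertices of
`G` and exactly the open edges of `G`. -/
def IsBondPercolation {V Ω : Type*} [MeasurableSpace Ω] (G : SimpleGraph V) (p : unitInterval)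
    (X : Ω → SimpleGraph V) (P : Measure Ω) : Prop :=
  IsSetBernoulli (fun ω => (X ω).edgeSet) G.edgeSet p P

/-- The events `A N` happen with high probability: their probabilities tend to `1`. -/
def WithHighProbability {Ω : ℕ → Type*} [∀ N, MeasurableSpace (Ω N)] (P : ∀ N, Measure (Ω N))
    (A : ∀ N, Set (Ω N)) : Prop :=
  Tendsto (fun N => P N (A N)) atTop (𝓝 1)

/-- `G` has a (unique) largest connected component, and the vertices outside this component are
exactly the isolated vertices (those of degree zero) of `G`. -/
def LargestComponentMissesOnlyIsolated {V : Type*} (G : SimpleGraph V) : Prop :=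
  ∃ C : G.ConnectedComponent,
    (∀ D : G.ConnectedComponent, D ≠ C → D.supp.ncard < C.supp.ncard) ∧
    ∀ v : V, v ∉ C.supp ↔ G.IsIsolated v

section BestResponse

variable {N : ℕ}

/-- For payoffs `z` (`z i s` is the payoff of player `i` at the profile `s`), the edge `[s, t]` of
the cube is oriented from `s` towards `t`: the player who deviates strictly gains. -/
def Toward (z : Fin N → Profile N → ℝ) (s t : Profile N) : Prop :=
  ∃ i, NeighborsAt i s t ∧ z i s < z i t

/-- The exploration from `a` along oriented edges. `explored z a k` is the set usually
indexed by `k + 1`: it is `{a}` for `k = 0`, and each step adds all out-neighbours. -/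
def explored (z : Fin N → Profile N → ℝ) (a : Profile N) : ℕ → Set (Profile N)
  | 0 => {a}
  | k + 1 => explored z a k ∪ {w | w ∉ explored z a k ∧ ∃ u ∈ explored z a k, Toward z u w}

/-- The edge `[u, w]` of the cube leads from `u ∈ U` to a neighbour `w` of `U` outside `U`. -/
def Leaves (U : Set (Profile N)) (u w : Profile N) : Prop :=
  (cube N).Adj u w ∧ u ∈ U ∧ w ∉ U

/-- Update the status of all and only the edges of the cube between `U` and its complement: such an
edge, from `u ∈ U` to `w ∉ U`, becomes open if it is oriented from `u` towards `w`, and closed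
otherwise. All the other edges keep their status in `B`. -/
def update (z : Fin N → Profile N → ℝ) (U : Set (Profile N)) (B : SimpleGraph (Profile N)) :
    SimpleGraph (Profile N) where
  Adj u w := (Leaves U u w ∧ Toward z u w) ∨ (Leaves U w u ∧ Toward z w u) ∨
    (¬ Leaves U u w ∧ ¬ Leaves U w u ∧ B.Adj u w)
  symm := ⟨fun u w h => by
    rcases h with h | h | ⟨h₁, h₂, h₃⟩
    · exact Or.inr (Or.inl h)
    · exact Or.inl h
    · exact Or.inr (Or.inr ⟨h₂, h₁, h₃.symm⟩)⟩
  loopless := ⟨fun u h => by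
    rcases h with h | h | ⟨_, _, h₃⟩
    · exact h.1.2.2 h.1.2.1
    · exact h.1.2.2 h.1.2.1
    · exact B.loopless.irrefl u h₃⟩

/-- The successive updates of `B` along the exploration from `a` (index shifted by one, as in
`explored`). -/
def stage (z : Fin N → Profile N → ℝ) (a : Profile N) (B : SimpleGraph (Profile N)) :
    ℕ → SimpleGraph (Profile N)
  | 0 => B
  | k + 1 => update z (explored z a k) (stage z a B k)

/-- The graph in the `2 ^ N`-th place of the sequence of updates that starts with `B` in the first
place. -/
def finalStage (z : Fin N → Profile N → ℝ) (a : Profile N) (B : SimpleGraph (Profile N)) :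
    SimpleGraph (Profile N) :=
  stage z a B (2 ^ N - 1)

end BestResponse

end NCube

namespace NCube

section Deterministic

open Finset

variable {N : ℕ}

/-- The neighbour of `u` in direction `i`. -/
def flipAt (i : Fin N) (u : Profile N) : Profile N := Function.update u i (!u i)

lemma flipAt_apply (i k : Fin N) (u : Profile N) :
    flipAt i u k = if k = i then !u k else u k := by
  by_cases h : k = i
  · subst h; simp [flipAt]
  · simp [flipAt, h]

@[simp] lemma flipAt_flipAt (i : Fin N) (u : Profile N) : flipAt i (flipAt i u) = u := by
  ext k; simp only [flipAt_apply]; split <;> simp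

lemma neighborsAt_iff {i : Fin N} {s t : Profile N} : NeighborsAt i s t ↔ t = flipAt i s := by
  constructor
  · rintro ⟨h, h'⟩
    funext k
    rw [flipAt_apply]
    split_ifs with hk
    · subst hk; revert h; cases s k <;> cases t k <;> simp
    · exact (h' k hk).symm
  · rintro rfl
    refine ⟨by simp [flipAt_apply], fun j hj => by simp [flipAt_apply, hj]⟩

lemma cube_adj_iff {s t : Profile N} : (cube N).Adj s t ↔ ∃ i, t = flipAt i s := by
  simp only [cube, neighborsAt_iff]

lemma flipAt_left_inj {i j : Fin N} {u : Profile N} : flipAt i u = flipAt j u ↔ i = j := by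
  refine ⟨fun h => ?_, fun h => h ▸ rfl⟩
  by_contra hij
  have := congrFun h i
  simp [flipAt_apply, hij] at this

/-- The directions of the edges of `X` at `u`. -/
noncomputable def openDirs (X : SimpleGraph (Profile N)) (u : Profile N) : Finset (Fin N) :=
  open Classical in {i | X.Adj u (flipAt i u)}

lemma mem_openDirs {X : SimpleGraph (Profile N)} {u : Profile N} {i : Fin N} :
    i ∈ openDirs X u ↔ X.Adj u (flipAt i u) := by simp [openDirs]

/-- `u` has fewer than `N / 16` neighbours in `X`. -/
def IsSparse (X : SimpleGraph (Profile N)) (u : Profile N) : Prop := 16 * #(openDirs X u) < N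

/-- The edges of the path from `u + i` to `u + p + q + j` that flips `j`, `p`, `q`, `i` in turn. -/
def detour (u : Profile N) (p q i j : Fin N) : Finset (Sym2 (Profile N)) :=
  {s(flipAt i u, flipAt j (flipAt i u)),
    s(flipAt j (flipAt i u), flipAt p (flipAt j (flipAt i u))),
    s(flipAt p (flipAt j (flipAt i u)), flipAt q (flipAt p (flipAt j (flipAt i u)))),
    s(flipAt q (flipAt p (flipAt j (flipAt i u))), flipAt j (flipAt q (flipAt p u)))}

/-- There are no two sparse vertices within distance two, and there are enough open detours between
any two vertices at distance two. -/
structure WellConnected (X : SimpleGraph (Profile N)) : Prop where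
  not_sparse_adj : ∀ u i, IsSparse X u → ¬ IsSparse X (flipAt i u)
  not_sparse_two : ∀ u i j, i ≠ j → IsSparse X u → ¬ IsSparse X (flipAt j (flipAt i u))
  exists_detour : ∀ u p q, p ≠ q → ∀ A B : Finset (Fin N), Disjoint A B →
    A ⊆ {p, q}ᶜ → B ⊆ {p, q}ᶜ → N / 64 ≤ #A → N / 64 ≤ #B →
    ∃ i ∈ A, ∃ j ∈ B, (detour u p q i j : Set (Sym2 (Profile N))) ⊆ X.edgeSet

variable {X : SimpleGraph (Profile N)}

lemma WellConnected.reachable_two (h : WellConnected X) (hN : 64 ≤ N) {u : Profile N} {p q : Fin N}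
    (hpq : p ≠ q) (hu : ¬ IsSparse X u) (hv : ¬ IsSparse X (flipAt q (flipAt p u))) :
    X.Reachable u (flipAt q (flipAt p u)) := by
  unfold IsSparse at hu hv
  have hc : #({p, q} : Finset (Fin N)) ≤ 2 := card_le_two
  have h1 := le_card_sdiff ({p, q} : Finset (Fin N)) (openDirs X u)
  obtain ⟨A, hA, hAc⟩ := exists_subset_card_eq
    (show N / 64 ≤ #(openDirs X u \ {p, q}) by omega)
  have h2 := le_card_sdiff ({p, q} : Finset (Fin N)) (openDirs X (flipAt q (flipAt p u)))
  have h3 := le_card_sdiff A (openDirs X (flipAt q (flipAt p u)) \ {p, q})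
  obtain ⟨i, hi, j, hj, hd⟩ := h.exists_detour u p q hpq A
    ((openDirs X (flipAt q (flipAt p u)) \ {p, q}) \ A) disjoint_sdiff
    (fun x hx => by have := hA hx; simp only [Finset.mem_sdiff] at this; simpa using this.2)
    (fun x hx => by simp only [Finset.mem_sdiff] at hx; simpa using hx.1.2)
    hAc.ge (by omega)
  have hi' : X.Adj u (flipAt i u) := mem_openDirs.1 (Finset.mem_sdiff.1 (hA hi)).1
  have hj' : X.Adj (flipAt q (flipAt p u)) (flipAt j (flipAt q (flipAt p u))) :=
    mem_openDirs.1 (Finset.mem_sdiff.1 (Finset.mem_sdiff.1 hj).1).1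
  simp only [detour, coe_insert, coe_singleton, Set.insert_subset_iff, Set.singleton_subset_iff,
    SimpleGraph.mem_edgeSet] at hd
  obtain ⟨d1, d2, d3, d4⟩ := hd
  exact hi'.reachable.trans (d1.reachable.trans (d2.reachable.trans (d3.reachable.trans
    (d4.reachable.trans hj'.symm.reachable))))

lemma WellConnected.reachable_adj (h : WellConnected X) (hN : 64 ≤ N) {u : Profile N} {p : Fin N}
    (hu : ¬ IsSparse X u) (hv : ¬ IsSparse X (flipAt p u)) :
    X.Reachable u (flipAt p u) := by
  have hu' := hu
  unfold IsSparse at hu'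
  have h1 := pred_card_le_card_erase (s := openDirs X u) (a := p)
  obtain ⟨i, hi, j, hj, hij⟩ := one_lt_card.1 (show 1 < #((openDirs X u).erase p) by omega)
  have key : ∀ k ∈ (openDirs X u).erase p, ¬ IsSparse X (flipAt k u) →
      X.Reachable u (flipAt p u) := by
    intro k hk hks
    rw [mem_erase, mem_openDirs] at hk
    have := h.reachable_two hN (u := flipAt k u) (p := k) (q := p) hk.1 hks (by simpa using hv)
    rw [flipAt_flipAt] at this
    exact hk.2.reachable.trans this
  by_cases hs : IsSparse X (flipAt i u)
  · refine key j hj ?_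
    have := h.not_sparse_two _ i j hij hs
    simpa using this
  · exact key i hi hs

lemma WellConnected.reachable (h : WellConnected X) (hN : 64 ≤ N) {u : Profile N}
    (hu : ¬ IsSparse X u) (n : ℕ) : ∀ v, hammingDist u v = n →
      (¬ IsSparse X v → X.Reachable u v) ∧
      (IsSparse X v → ∀ i, ¬ IsSparse X (flipAt i v) → X.Reachable u (flipAt i v)) := by
  induction n with
  | zero =>
    intro v hv
    obtain rfl := hammingDist_eq_zero.1 hv
    exact ⟨fun _ => .rfl, fun hs => absurd hs hu⟩
  | succ n ih =>
    intro v hv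
    obtain ⟨k, hk⟩ : ∃ k, u k ≠ v k := by
      by_contra! hcon
      have : hammingDist u v = 0 := hammingDist_eq_zero.2 (funext hcon)
      omega
    have hd : hammingDist u (flipAt k v) = n := by
      have : ({i | u i ≠ flipAt k v i} : Finset (Fin N)) = ({i | u i ≠ v i} : Finset _).erase k := by
        ext i
        simp only [mem_filter, mem_univ, true_and, mem_erase, flipAt_apply]
        by_cases hik : i = k
        · subst hik; revert hk; cases u i <;> cases v i <;> simp
        · simp [hik]
      unfold hammingDist at hv ⊢
      rw [this, card_erase_of_mem (by simpa using hk), hv]; rfl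
    obtain ⟨ih1, ih2⟩ := ih _ hd
    by_cases hs : IsSparse X v
    · refine ⟨fun h' => absurd hs h', fun _ i hi => ?_⟩
      have hw := h.not_sparse_adj v k hs
      by_cases hik : i = k
      · subst hik; exact ih1 hi
      · have := h.reachable_two hN (u := flipAt k v) (p := k) (q := i) (Ne.symm hik) hw
          (by simpa using hi)
        rw [flipAt_flipAt] at this
        exact (ih1 hw).trans this
    · refine ⟨fun _ => ?_, fun h' => absurd h' hs⟩
      by_cases hw : IsSparse X (flipAt k v)
      · simpa using ih2 hw k (by simpa using hs)
      · have := h.reachable_adj hN (p := k) hw (by simpa using hs)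
        rw [flipAt_flipAt] at this
        exact (ih1 hw).trans this

lemma WellConnected.largestComponent (h : WellConnected X) (hX : X ≤ cube N) (hN : 64 ≤ N) :
    LargestComponentMissesOnlyIsolated X := by
  obtain ⟨u, hu⟩ : ∃ u, ¬ IsSparse X u := by
    by_contra! hcon
    exact h.not_sparse_adj (fun _ => false) ⟨0, by omega⟩ (hcon _) (hcon _)
  have hout : ∀ v, ¬ X.Reachable u v → X.IsIsolated v := by
    intro v hv w hvw
    obtain ⟨i, rfl⟩ := cube_adj_iff.1 (hX hvw)
    have hr := h.reachable hN hu _ v rfl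
    by_cases hs : IsSparse X v
    · exact hv ((hr.2 hs i (h.not_sparse_adj v i hs)).trans hvw.symm.reachable)
    · exact hv (hr.1 hs)
  obtain ⟨i, hi⟩ : (openDirs X u).Nonempty := by
    rw [← card_pos]; unfold IsSparse at hu; omega
  rw [mem_openDirs] at hi
  have mem_iff : ∀ v, v ∈ (X.connectedComponentMk u).supp ↔ X.Reachable u v := fun v => by
    rw [SimpleGraph.ConnectedComponent.mem_supp_iff, SimpleGraph.ConnectedComponent.eq]
    exact SimpleGraph.reachable_comm
  refine ⟨X.connectedComponentMk u, fun D hD => ?_, fun v => ?_⟩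
  · have h2 : 1 < (X.connectedComponentMk u).supp.ncard := by
      rw [Set.one_lt_ncard (Set.toFinite _)]
      exact ⟨u, (mem_iff _).2 .rfl, _, (mem_iff _).2 hi.reachable, hi.ne⟩
    refine lt_of_le_of_lt ?_ h2
    rw [Set.ncard_le_one (Set.toFinite _)]
    induction D using SimpleGraph.ConnectedComponent.ind with | _ v
    have hv : X.IsIsolated v := hout v fun hr => hD (SimpleGraph.ConnectedComponent.eq.2 hr.symm)
    have key : ∀ w ∈ (X.connectedComponentMk v).supp, w = v := by
      intro w hw
      rw [SimpleGraph.ConnectedComponent.mem_supp_iff, SimpleGraph.ConnectedComponent.eq] at hw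
      by_contra hne
      exact hw.symm.elim fun p => by
        cases p with
        | nil => exact hne rfl
        | cons hadj _ => exact hv _ hadj
    intro a ha b hb
    rw [key a ha, key b hb]
  · rw [mem_iff]
    refine ⟨hout v, fun hv hr => ?_⟩
    exact hr.symm.elim fun p => by
      cases p with
      | nil => exact hv _ hi
      | cons hadj _ => exact hv _ hadj

end Deterministic

end NCube

section Independence

/-- Events that depend on disjoint blocks of an independent family are independent. -/
lemma iIndep.measure_biInter_of_pairwiseDisjoint {Ω ι κ : Type*} {mΩ : MeasurableSpace Ω}
    {μ : Measure Ω} {m : ι → MeasurableSpace Ω} (h_le : ∀ i, m i ≤ mΩ) (h : iIndep m μ)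
    {S : κ → Set ι} {A : κ → Set Ω} (K : Finset κ) (hS : (K : Set κ).PairwiseDisjoint S)
    (hA : ∀ k ∈ K, MeasurableSet[⨆ i ∈ S k, m i] (A k)) :
    μ (⋂ k ∈ K, A k) = ∏ k ∈ K, μ (A k) := by
  classical
  have := h.isProbabilityMeasure
  induction K using Finset.induction_on with
  | empty => simp
  | insert k K hk ih =>
    rw [Finset.prod_insert hk, Finset.set_biInter_insert,
      ← ih (hS.subset (by simp)) fun j hj => hA j (Finset.mem_insert_of_mem hj)]
    have hd : Disjoint (S k) (⋃ j ∈ K, S j) := by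
      simp only [Set.disjoint_iUnion_right]
      intro j hj
      exact hS (by simp) (by simp [hj]) (by rintro rfl; exact hk hj)
    refine (Indep_iff _ _ _).1 (indep_iSup_of_disjoint h_le h hd) _ _ (hA k (by simp)) ?_
    refine Finset.measurableSet_biInter _ fun j hj => ?_
    exact (iSup₂_mono' fun i hi => ⟨i, Set.mem_biUnion hj hi, le_rfl⟩ :
      (⨆ i ∈ S j, m i) ≤ _) _ (hA j (Finset.mem_insert_of_mem hj))

end Independence

section SetBernoulli

open Finset

variable {ι : Type*} {u : Set ι} {p : unitInterval}

lemma setBernoulli_map_mem : (setBernoulli u p).map (fun s e => e ∈ s) =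
    Measure.infinitePi fun i : ι => unitInterval.toNNReal p • Measure.dirac (i ∈ u) +
      unitInterval.toNNReal (unitInterval.symm p) • Measure.dirac False := by
  rw [setBernoulli_eq_map, Measure.map_map (by fun_prop) (by fun_prop)]
  exact Measure.map_id

lemma setBernoulli_map_mem_apply (e : ι) : (setBernoulli u p).map (fun s => e ∈ s) =
    unitInterval.toNNReal p • Measure.dirac (e ∈ u) +
      unitInterval.toNNReal (unitInterval.symm p) • Measure.dirac False := by
  have h := Measure.infinitePi_map_eval (fun i : ι =>
    unitInterval.toNNReal p • Measure.dirac (i ∈ u) +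
      unitInterval.toNNReal (unitInterval.symm p) • Measure.dirac False) e
  rw [← h, ← setBernoulli_map_mem, Measure.map_map (by fun_prop) (by fun_prop)]
  rfl

lemma iIndepFun_mem_setBernoulli :
    iIndepFun (fun (e : ι) (s : Set ι) => e ∈ s) (setBernoulli u p) := by
  rw [iIndepFun_iff_map_fun_eq_infinitePi_map (by fun_prop), setBernoulli_map_mem]
  simp_rw [setBernoulli_map_mem_apply]

lemma setBernoulli_real_mem {e : ι} (he : e ∈ u) :
    (setBernoulli u p).real {s | e ∈ s} = p := by
  have h := congrArg (fun μ => μ {True}) (setBernoulli_map_mem_apply (u := u) (p := p) e)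
  rw [Measure.map_apply (by fun_prop) (by simp)] at h
  have h2 : (fun s : Set ι => e ∈ s) ⁻¹' {True} = {s | e ∈ s} := by ext; simp
  rw [measureReal_def, ← h2, h]
  simp [he]

lemma setBernoulli_real_forall_mem {M : Finset ι} (hM : (M : Set ι) ⊆ u) :
    (setBernoulli u p).real {s | (M : Set ι) ⊆ s} = p ^ #M := by
  have h := (iIndepFun_mem_setBernoulli (u := u) (p := p)).meas_biInter (S := M)
    (s := fun e => {s | e ∈ s}) fun e _ => ⟨{True}, by simp, by ext; simp⟩
  have h2 : {s : Set ι | (M : Set ι) ⊆ s} = ⋂ e ∈ M, {s | e ∈ s} := by ext; simp [Set.subset_def]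
  rw [h2, measureReal_def, h, ENNReal.toReal_prod, prod_congr rfl fun e he => ?_, prod_const]
  exact setBernoulli_real_mem (hM he)

/-- Under the uniform law, every pattern on a finite set of coordinates has the same mass. -/
lemma setBernoulli_real_pattern (hp : (p : ℝ) = 1 / 2) {S : Finset ι} (hS : (S : Set ι) ⊆ u)
    (T : Set ι) : (setBernoulli u p).real {s | ∀ e ∈ S, (e ∈ s ↔ e ∈ T)} = (1 / 2) ^ #S := by
  have h := (iIndepFun_mem_setBernoulli (u := u) (p := p)).meas_biInter (S := S)
    (s := fun e => {s | e ∈ s ↔ e ∈ T}) fun e _ => ⟨{q | q ↔ e ∈ T}, .of_discrete, rfl⟩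
  have h2 : {s : Set ι | ∀ e ∈ S, (e ∈ s ↔ e ∈ T)} = ⋂ e ∈ S, {s | e ∈ s ↔ e ∈ T} := by
    ext; simp
  rw [h2, measureReal_def, h, ENNReal.toReal_prod, prod_congr rfl fun e he => ?_, prod_const]
  rw [← measureReal_def]
  by_cases heT : e ∈ T
  · simp only [heT, iff_true]
    rw [setBernoulli_real_mem (hS he), hp]
  · simp only [heT, iff_false]
    have h3 : {s : Set ι | e ∉ s} = {s | e ∈ s}ᶜ := rfl
    rw [h3, probReal_compl_eq_one_sub (measurableSet_mem e), setBernoulli_real_mem (hS he), hp]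
    norm_num

open Classical in
/-- A Chernoff bound for the lower tail of a binomial law with parameter `1 / 2`. -/
lemma setBernoulli_real_card_le (hp : (p : ℝ) = 1 / 2) {S : Finset ι} (hS : (S : Set ι) ⊆ u)
    (r : ℕ) : (setBernoulli u p).real {s | #{e ∈ S | e ∈ s} ≤ r} ≤ (9 / 16) ^ #S * 8 ^ r := by
  have hsub : {s : Set ι | #{e ∈ S | e ∈ s} ≤ r} ⊆
      ⋃ T ∈ S.powerset.filter (#· ≤ r), {s | ∀ e ∈ S, (e ∈ s ↔ e ∈ (T : Set ι))} := by
    intro s hs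
    simp only [Set.mem_iUnion]
    refine ⟨{e ∈ S | e ∈ s}, by simpa using hs, fun e he => by simp [he]⟩
  calc (setBernoulli u p).real {s | #{e ∈ S | e ∈ s} ≤ r}
      ≤ _ := measureReal_mono hsub (measure_ne_top _ _)
    _ ≤ ∑ T ∈ S.powerset.filter (#· ≤ r), (1 / 2 : ℝ) ^ #S := by
      refine (measureReal_biUnion_finset_le _ _).trans (sum_le_sum fun T _ => ?_)
      exact (setBernoulli_real_pattern hp hS _).le
    _ ≤ ∑ T ∈ S.powerset.filter (#· ≤ r), (1 / 2 : ℝ) ^ #S * (8 ^ r * (1 / 8) ^ #T) := by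
      refine sum_le_sum fun T hT => le_mul_of_one_le_right (by positivity) ?_
      rw [one_div, inv_pow, ← div_eq_mul_inv, one_le_div (by positivity)]
      exact pow_le_pow_right₀ (by norm_num) (mem_filter.1 hT).2
    _ ≤ ∑ T ∈ S.powerset, (1 / 2 : ℝ) ^ #S * (8 ^ r * (1 / 8) ^ #T) :=
      sum_le_sum_of_subset_of_nonneg (filter_subset _ _) fun _ _ _ => by positivity
    _ = (9 / 16) ^ #S * 8 ^ r := by
      have h := sum_pow_mul_eq_add_pow (1 / 8 : ℝ) 1 S
      simp only [one_pow, mul_one] at h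
      rw [← mul_sum, ← mul_sum, h, mul_left_comm, ← mul_pow]
      norm_num [mul_comm]

/-- Disjoint sets of at most four coordinates are unlikely to be all missed. -/
lemma setBernoulli_real_forall_not_subset_le (hp : (p : ℝ) = 1 / 2) {κ : Type*} (K : Finset κ)
    {M : κ → Finset ι} (hM : ∀ k ∈ K, (M k : Set ι) ⊆ u) (hc : ∀ k ∈ K, #(M k) ≤ 4)
    (hd : (K : Set κ).PairwiseDisjoint fun k => (M k : Set ι)) :
    (setBernoulli u p).real {s | ∀ k ∈ K, ¬ (M k : Set ι) ⊆ s} ≤ (15 / 16) ^ #K := by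
  have hmeas : ∀ k, MeasurableSet[⨆ e ∈ (M k : Set ι),
      MeasurableSpace.comap (fun s : Set ι => e ∈ s) inferInstance] {s | ¬ (M k : Set ι) ⊆ s} := by
    intro k
    have h2 : {s : Set ι | ¬ (M k : Set ι) ⊆ s} = (⋂ e ∈ M k, {s | e ∈ s})ᶜ := by
      ext; simp [Set.subset_def]
    rw [h2]
    refine MeasurableSet.compl (Finset.measurableSet_biInter _ fun e he => ?_)
    exact (le_iSup₂_of_le e (by exact he) le_rfl :
      MeasurableSpace.comap (fun s : Set ι => e ∈ s) inferInstance ≤ _) _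
      ⟨{True}, by simp, by ext; simp⟩
  have h := iIndep.measure_biInter_of_pairwiseDisjoint (μ := setBernoulli u p)
    (fun e => (measurable_set_mem e).comap_le) iIndepFun_mem_setBernoulli.iIndep K hd
    fun k _ => hmeas k
  have h2 : {s : Set ι | ∀ k ∈ K, ¬ (M k : Set ι) ⊆ s} = ⋂ k ∈ K, {s | ¬ (M k : Set ι) ⊆ s} := by
    ext; simp
  rw [h2, measureReal_def, h, ENNReal.toReal_prod, ← prod_const]
  refine prod_le_prod (fun _ _ => by positivity) fun k hk => ?_
  have h3 : {s : Set ι | ¬ (M k : Set ι) ⊆ s} = {s | (M k : Set ι) ⊆ s}ᶜ := rfl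
  have h4 : MeasurableSet {s : Set ι | (M k : Set ι) ⊆ s} := by
    have : {s : Set ι | (M k : Set ι) ⊆ s} = ⋂ e ∈ M k, {s | e ∈ s} := by ext; simp [Set.subset_def]
    rw [this]
    exact Finset.measurableSet_biInter _ fun e _ => measurableSet_mem e
  rw [← measureReal_def, h3, probReal_compl_eq_one_sub h4, setBernoulli_real_forall_mem (hM k hk),
    hp]
  have : (1 / 2 : ℝ) ^ 4 ≤ (1 / 2) ^ #(M k) :=
    pow_le_pow_of_le_one (by norm_num) (by norm_num) (hc k hk)
  norm_num at this ⊢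
  linarith

end SetBernoulli

namespace NCube

section UnionBound

open Finset

lemma measureReal_exists_le {Ω κ : Type*} [MeasurableSpace Ω] {μ : Measure Ω} [IsFiniteMeasure μ]
    [Fintype κ] {E : κ → Set Ω} {c : ℝ} (h : ∀ k, μ.real (E k) ≤ c) :
    μ.real {ω | ∃ k, ω ∈ E k} ≤ Fintype.card κ * c := by
  have h1 : {ω | ∃ k, ω ∈ E k} = ⋃ k ∈ (univ : Finset κ), E k := by ext; simp
  rw [h1]
  refine (measureReal_biUnion_finset_le _ _).trans ((sum_le_sum fun k _ => h k).trans ?_)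
  simp

variable {N : ℕ} {β : unitInterval}

lemma flipAt_ne (i : Fin N) (u : Profile N) : flipAt i u ≠ u := fun h => by
  have := congrFun h i
  simp [flipAt_apply] at this

lemma mem_openDirs_fromEdgeSet {s : Set (Sym2 (Profile N))} {u : Profile N} {i : Fin N} :
    i ∈ openDirs (SimpleGraph.fromEdgeSet s) u ↔ s(u, flipAt i u) ∈ s := by
  simp [mem_openDirs, (flipAt_ne i u).symm]

lemma mk_flipAt_mem_edgeSet (i : Fin N) (u : Profile N) : s(u, flipAt i u) ∈ (cube N).edgeSet := by
  rw [SimpleGraph.mem_edgeSet, cube_adj_iff]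
  exact ⟨i, rfl⟩

/-- The edges of the cube at `u`. -/
def star (u : Profile N) : Finset (Sym2 (Profile N)) := univ.image fun i => s(u, flipAt i u)

lemma card_star (u : Profile N) : #(star u) = N := by
  rw [star, card_image_of_injective, card_univ, Fintype.card_fin]
  intro i j h
  simpa [flipAt_left_inj, (flipAt_ne i u)] using h

lemma measureReal_sparse_sparse_le (hβ : (β : ℝ) = 1 / 2) {u v : Profile N} (huv : u ≠ v) :
    (setBernoulli (cube N).edgeSet β).real {s | IsSparse (SimpleGraph.fromEdgeSet s) u ∧
      IsSparse (SimpleGraph.fromEdgeSet s) v} ≤ 16 / 9 * (53 / 128) ^ N := by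
  classical
  set S := star u ∪ (star v).erase s(u, v) with hS
  have hSE : (S : Set (Sym2 (Profile N))) ⊆ (cube N).edgeSet := by
    intro e he
    simp only [hS, coe_union, Set.mem_union, mem_coe, star, mem_erase, mem_image, mem_univ,
      true_and] at he
    obtain ⟨i, rfl⟩ | ⟨_, i, rfl⟩ := he <;> exact mk_flipAt_mem_edgeSet _ _
  have hdisj : Disjoint (star u) ((star v).erase s(u, v)) := by
    rw [disjoint_left]
    intro e he he'
    simp only [star, mem_erase, mem_image, mem_univ, true_and] at he he'
    obtain ⟨i, rfl⟩ := he
    obtain ⟨hne, j, hj⟩ := he'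
    have hvmem : v ∈ s(u, flipAt i u) := hj ▸ Sym2.mem_mk_left _ _
    rcases Sym2.mem_iff.1 hvmem with h | h
    · exact huv h.symm
    · exact hne (by rw [h])
  have hcard : 2 * N - 1 ≤ #S := by
    have := pred_card_le_card_erase (s := star v) (a := s(u, v))
    rw [card_star] at this
    rw [hS, card_union_of_disjoint hdisj, card_star]
    omega
  have hsub : {s | IsSparse (SimpleGraph.fromEdgeSet s) u ∧
      IsSparse (SimpleGraph.fromEdgeSet s) v} ⊆ {s | #{e ∈ S | e ∈ s} ≤ N / 8} := by
    rintro s ⟨h1, h2⟩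
    unfold IsSparse at h1 h2
    have hle : #{e ∈ S | e ∈ s} ≤ #(openDirs (SimpleGraph.fromEdgeSet s) u) +
        #(openDirs (SimpleGraph.fromEdgeSet s) v) := by
      refine (card_le_card (t := (openDirs (SimpleGraph.fromEdgeSet s) u).image
        (fun i => s(u, flipAt i u)) ∪ (openDirs (SimpleGraph.fromEdgeSet s) v).image
        (fun i => s(v, flipAt i v))) ?_).trans
        ((card_union_le _ _).trans (add_le_add card_image_le card_image_le))
      intro e he
      simp only [hS, mem_filter, mem_union, star, mem_erase, mem_image, mem_univ, true_and,
        mem_openDirs_fromEdgeSet] at he ⊢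
      obtain ⟨⟨i, rfl⟩ | ⟨_, i, rfl⟩, hes⟩ := he
      · exact Or.inl ⟨i, hes, rfl⟩
      · exact Or.inr ⟨i, hes, rfl⟩
    simp only [Set.mem_ofPred_eq]
    omega
  refine (measureReal_mono hsub (measure_ne_top _ _)).trans
    ((setBernoulli_real_card_le hβ hSE _).trans ?_)
  have h8 : (8 : ℝ) ^ (N / 8) ≤ (212 / 162) ^ N := by
    calc (8 : ℝ) ^ (N / 8) ≤ ((212 / 162) ^ 8) ^ (N / 8) :=
          pow_le_pow_left₀ (by norm_num) (by norm_num) _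
      _ = (212 / 162) ^ (8 * (N / 8)) := by rw [pow_mul]
      _ ≤ _ := pow_le_pow_right₀ (by norm_num) (Nat.mul_div_le _ _)
  have h9 : (9 / 16 : ℝ) ^ #S ≤ 16 / 9 * ((9 / 16) ^ 2) ^ N := by
    refine (pow_le_pow_of_le_one (by norm_num) (by norm_num) hcard).trans ?_
    rw [← pow_mul]
    rcases N with _ | n
    · norm_num
    · rw [show 2 * (n + 1) = (2 * (n + 1) - 1) + 1 by omega, pow_succ]
      apply le_of_eq
      rw [show 2 * (n + 1) - 1 + 1 - 1 = 2 * (n + 1) - 1 by omega]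
      ring
  calc (9 / 16 : ℝ) ^ #S * 8 ^ (N / 8)
      ≤ (16 / 9 * ((9 / 16) ^ 2) ^ N) * (212 / 162) ^ N := by gcongr
    _ = 16 / 9 * (53 / 128) ^ N := by rw [mul_assoc, ← mul_pow]; norm_num

lemma detour_subset_edgeSet (u : Profile N) (p q i j : Fin N) :
    (detour u p q i j : Set (Sym2 (Profile N))) ⊆ (cube N).edgeSet := by
  have h : flipAt j (flipAt q (flipAt p u)) =
      flipAt i (flipAt q (flipAt p (flipAt j (flipAt i u)))) := by
    ext k; simp only [flipAt_apply]; split_ifs <;> simp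
  simp only [detour, coe_insert, coe_singleton, Set.insert_subset_iff, Set.singleton_subset_iff]
  refine ⟨mk_flipAt_mem_edgeSet _ _, mk_flipAt_mem_edgeSet _ _, mk_flipAt_mem_edgeSet _ _, ?_⟩
  rw [h]
  exact mk_flipAt_mem_edgeSet _ _

lemma exists_ne_of_mem_detour {u : Profile N} {p q i j : Fin N} (hij : i ≠ j)
    {e : Sym2 (Profile N)} (he : e ∈ detour u p q i j) (k : Fin N) (hp : k ≠ p) (hq : k ≠ q) :
    (∃ w ∈ e, w k ≠ u k) ↔ k = i ∨ k = j := by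
  simp only [detour, mem_insert, mem_singleton] at he
  rcases he with rfl | rfl | rfl | rfl <;>
  · simp only [Sym2.mem_iff, exists_eq_or_imp, exists_eq_left, flipAt_apply, hp, hq, if_false]
    by_cases h1 : k = i
    · have h2 : k ≠ j := fun h => hij (h1.symm.trans h)
      simp [h1, h1 ▸ h2]
    · by_cases h2 : k = j
      · subst h2; simp [h1]
      · simp [h1, h2]

lemma measureReal_no_detour_le (hβ : (β : ℝ) = 1 / 2) {u : Profile N} {p q : Fin N}
    {A B : Finset (Fin N)} (hAB : Disjoint A B) (hA : A ⊆ {p, q}ᶜ) (hB : B ⊆ {p, q}ᶜ) :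
    (setBernoulli (cube N).edgeSet β).real
      {s | ∀ i ∈ A, ∀ j ∈ B, ¬ (detour u p q i j : Set (Sym2 (Profile N))) ⊆ s} ≤
      (15 / 16) ^ (#A * #B) := by
  have h := setBernoulli_real_forall_not_subset_le (u := (cube N).edgeSet) hβ (A ×ˢ B)
    (M := fun k => detour u p q k.1 k.2) (fun _ _ => detour_subset_edgeSet ..)
    (fun _ _ => card_le_four) ?_
  · rw [card_product] at h
    refine le_of_eq_of_le (congrArg _ (Set.ext fun s => ?_)) h
    exact ⟨fun hs k hk => hs _ (mem_product.1 hk).1 _ (mem_product.1 hk).2,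
      fun hs i hi j hj => hs (i, j) (mem_product.2 ⟨hi, hj⟩)⟩
  · rintro ⟨i, j⟩ hk ⟨i', j'⟩ hk' hne
    simp only [coe_product, Set.mem_prod, mem_coe] at hk hk'
    simp only [Function.onFun, Set.disjoint_left, mem_coe]
    intro e he he'
    have hav : ∀ k, k ∈ A ∨ k ∈ B → k ≠ p ∧ k ≠ q := by
      rintro k (hk | hk)
      · simpa using hA hk
      · simpa using hB hk
    have hn : ∀ x ∈ A, ∀ y ∈ B, x ≠ y := fun x hx y hy h =>
      disjoint_left.1 hAB hx (h ▸ hy)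
    have key : ∀ k, k ∈ A ∨ k ∈ B → (k = i ∨ k = j ↔ k = i' ∨ k = j') := fun k hk0 => by
      rw [← exists_ne_of_mem_detour (hn i hk.1 j hk.2) he k (hav k hk0).1 (hav k hk0).2,
        ← exists_ne_of_mem_detour (hn i' hk'.1 j' hk'.2) he' k (hav k hk0).1 (hav k hk0).2]
    have h1 : i = i' := ((key i (Or.inl hk.1)).1 (Or.inl rfl)).resolve_right (hn i hk.1 j' hk'.2)
    have h2 : j = j' :=
      ((key j (Or.inr hk.2)).1 (Or.inr rfl)).resolve_left (hn i' hk'.1 j hk.2).symm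
    exact hne (by rw [h1, h2])

lemma measureReal_not_wellConnected_le (hβ : (β : ℝ) = 1 / 2) (N : ℕ) :
    (setBernoulli (cube N).edgeSet β).real {s | ¬ WellConnected (SimpleGraph.fromEdgeSet s)} ≤
      2 ^ N * N * (16 / 9 * (53 / 128) ^ N) + 2 ^ N * N * N * (16 / 9 * (53 / 128) ^ N) +
      2 ^ N * N * N * 2 ^ N * 2 ^ N * (15 / 16) ^ (N / 64 * (N / 64)) := by
  set ν := setBernoulli (cube N).edgeSet β
  set E₁ : Profile N × Fin N → Set (Set (Sym2 (Profile N))) := fun x =>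
    {s | IsSparse (SimpleGraph.fromEdgeSet s) x.1 ∧
      IsSparse (SimpleGraph.fromEdgeSet s) (flipAt x.2 x.1)}
  set E₂ : (Profile N × Fin N) × Fin N → Set (Set (Sym2 (Profile N))) := fun x =>
    {s | x.1.2 ≠ x.2 ∧ IsSparse (SimpleGraph.fromEdgeSet s) x.1.1 ∧
      IsSparse (SimpleGraph.fromEdgeSet s) (flipAt x.2 (flipAt x.1.2 x.1.1))}
  set E₃ : (((Profile N × Fin N) × Fin N) × Finset (Fin N)) × Finset (Fin N) →
      Set (Set (Sym2 (Profile N))) := fun x =>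
    {s | Disjoint x.1.2 x.2 ∧ x.1.2 ⊆ {x.1.1.1.2, x.1.1.2}ᶜ ∧ x.2 ⊆ {x.1.1.1.2, x.1.1.2}ᶜ ∧
      N / 64 ≤ #x.1.2 ∧ N / 64 ≤ #x.2 ∧ ∀ i ∈ x.1.2, ∀ j ∈ x.2,
      ¬ (detour x.1.1.1.1 x.1.1.1.2 x.1.1.2 i j : Set (Sym2 (Profile N))) ⊆ s}
  have h1 : ∀ x, ν.real (E₁ x) ≤ 16 / 9 * (53 / 128) ^ N := fun x =>
    measureReal_sparse_sparse_le hβ (flipAt_ne _ _).symm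
  have h2 : ∀ x, ν.real (E₂ x) ≤ 16 / 9 * (53 / 128) ^ N := by
    rintro ⟨⟨u, i⟩, j⟩
    by_cases hij : i = j
    · have : E₂ ((u, i), j) = ∅ := by ext; simp [E₂, hij]
      rw [this, measureReal_empty]
      positivity
    · refine (measureReal_mono (fun s hs => hs.2) (measure_ne_top _ _)).trans
        (measureReal_sparse_sparse_le hβ (u := u) (v := flipAt j (flipAt i u)) fun h => ?_)
      have := congrFun h i
      simp [flipAt_apply, hij] at this
  have h3 : ∀ x, ν.real (E₃ x) ≤ (15 / 16) ^ (N / 64 * (N / 64)) := by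
    rintro ⟨⟨⟨⟨u, p⟩, q⟩, A⟩, B⟩
    by_cases hc : Disjoint A B ∧ A ⊆ {p, q}ᶜ ∧ B ⊆ {p, q}ᶜ ∧ N / 64 ≤ #A ∧ N / 64 ≤ #B
    · obtain ⟨c1, c2, c3, c4, c5⟩ := hc
      refine (measureReal_mono (fun s hs => hs.2.2.2.2.2) (measure_ne_top _ _)).trans
        ((measureReal_no_detour_le hβ (u := u) c1 c2 c3).trans ?_)
      exact pow_le_pow_of_le_one (by norm_num) (by norm_num) (Nat.mul_le_mul c4 c5)
    · have : E₃ ((((u, p), q), A), B) = ∅ := by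
        ext s
        simp only [E₃, Set.mem_ofPred_eq, Set.mem_empty_iff_false, iff_false]
        rintro ⟨c1, c2, c3, c4, c5, _⟩
        exact hc ⟨c1, c2, c3, c4, c5⟩
      rw [this, measureReal_empty]
      positivity
  have hsub : {s | s ⊆ (cube N).edgeSet ∧ ¬ WellConnected (SimpleGraph.fromEdgeSet s)} ⊆
      ({s | ∃ x, s ∈ E₁ x} ∪ {s | ∃ x, s ∈ E₂ x}) ∪ {s | ∃ x, s ∈ E₃ x} := by
    rintro s ⟨hs, hw⟩
    by_contra hcon
    simp only [Set.mem_union, Set.mem_ofPred_eq, not_or, not_exists] at hcon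
    obtain ⟨⟨c1, c2⟩, c3⟩ := hcon
    refine hw ⟨fun u i hu hv => c1 (u, i) ⟨hu, hv⟩,
      fun u i j hij hu hv => c2 ((u, i), j) ⟨hij, hu, hv⟩,
      fun u p q _ A B d1 d2 d3 d4 d5 => ?_⟩
    by_contra! hno
    refine c3 ((((u, p), q), A), B) ⟨d1, d2, d3, d4, d5, fun i hi j hj hd => hno i hi j hj ?_⟩
    rw [SimpleGraph.edgeSet_fromEdgeSet]
    intro e he
    refine ⟨hd he, ?_⟩
    exact SimpleGraph.not_isDiag_of_mem_edgeSet _ (detour_subset_edgeSet _ _ _ _ _ he)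
  have hae : ν.real {s | ¬ WellConnected (SimpleGraph.fromEdgeSet s)} =
      ν.real {s | s ⊆ (cube N).edgeSet ∧ ¬ WellConnected (SimpleGraph.fromEdgeSet s)} := by
    rw [measureReal_def, measureReal_def, setBernoulli_apply_eq_apply_subsets]
    congr 2
    ext s
    simp [and_comm]
  rw [hae]
  refine (measureReal_mono hsub (measure_ne_top _ _)).trans ((measureReal_union_le _ _).trans
    (add_le_add ((measureReal_union_le _ _).trans (add_le_add ?_ ?_)) ?_))
  · simpa using measureReal_exists_le h1
  · simpa using measureReal_exists_le h2
  · simpa using measureReal_exists_le h3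

end UnionBound

lemma tendsto_union_bound : Tendsto (fun N : ℕ =>
    (2 ^ N * N * (16 / 9 * (53 / 128) ^ N) + 2 ^ N * N * N * (16 / 9 * (53 / 128) ^ N) +
      2 ^ N * N * N * 2 ^ N * 2 ^ N * (15 / 16) ^ (N / 64 * (N / 64)) : ℝ)) atTop (𝓝 0) := by
  have h1 := (tendsto_pow_const_mul_const_pow_of_abs_lt_one 1
    (show |(53 / 64 : ℝ)| < 1 by rw [abs_of_pos] <;> norm_num)).const_mul (16 / 9)
  have h2 := (tendsto_pow_const_mul_const_pow_of_abs_lt_one 2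
    (show |(53 / 64 : ℝ)| < 1 by rw [abs_of_pos] <;> norm_num)).const_mul (16 / 9)
  have h3 := tendsto_pow_const_mul_const_pow_of_abs_lt_one 2
    (show |(1 / 2 : ℝ)| < 1 by rw [abs_of_pos] <;> norm_num)
  have h := (h1.add h2).add h3
  simp only [mul_zero, add_zero] at h
  refine tendsto_of_tendsto_of_tendsto_of_le_of_le' tendsto_const_nhds h
    (Eventually.of_forall fun N => by positivity) ?_
  have hdiv : Tendsto (fun N : ℕ => N / 64) atTop atTop := Nat.tendsto_div_const_atTop (by norm_num)
  have hsmall : ∀ᶠ N : ℕ in atTop, (15 / 16 : ℝ) ^ (N / 64) < (1 / 16) ^ 128 :=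
    ((tendsto_pow_atTop_nhds_zero_of_lt_one (by norm_num) (by norm_num)).comp hdiv).eventually_lt_const
      (by positivity)
  filter_upwards [hsmall, eventually_ge_atTop 64] with N hN h64
  have hpow : (15 / 16 : ℝ) ^ (N / 64 * (N / 64)) ≤ (1 / 16) ^ N := by
    rw [pow_mul]
    refine (pow_le_pow_left₀ (by positivity) hN.le _).trans ?_
    rw [← pow_mul]
    exact pow_le_pow_of_le_one (by norm_num) (by norm_num) (by omega)
  have e1 : (2 : ℝ) ^ N * (53 / 128) ^ N = (53 / 64) ^ N := by rw [← mul_pow]; norm_num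
  have e2 : (2 : ℝ) ^ N * 2 ^ N * 2 ^ N * (1 / 16) ^ N = (1 / 2) ^ N := by
    rw [← mul_pow, ← mul_pow, ← mul_pow]; norm_num
  calc _ ≤ (2 ^ N * N * (16 / 9 * (53 / 128) ^ N) + 2 ^ N * N * N * (16 / 9 * (53 / 128) ^ N) +
      2 ^ N * N * N * 2 ^ N * 2 ^ N * (1 / 16) ^ N : ℝ) := by gcongr
    _ = 16 / 9 * (N ^ 1 * (2 ^ N * (53 / 128) ^ N)) + 16 / 9 * (N ^ 2 * (2 ^ N * (53 / 128) ^ N)) +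
      N ^ 2 * (2 ^ N * 2 ^ N * 2 ^ N * (1 / 16) ^ N) := by ring
    _ ≤ _ := by rw [e1, e2]

lemma withHighProbability_of_isBondPercolation {β : unitInterval} (hβ : (β : ℝ) = 1 / 2)
    {Ω : ℕ → Type*} [∀ N, MeasurableSpace (Ω N)] {P : ∀ N, Measure (Ω N)}
    {B : ∀ N, Ω N → SimpleGraph (Profile N)}
    (hB : ∀ N, IsBondPercolation (cube N) β (B N) (P N)) :
    WithHighProbability P fun N => {ω | LargestComponentMissesOnlyIsolated (B N ω)} := by
  set Q : ∀ N, Set (Set (Sym2 (Profile N))) := fun N =>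
    {s | LargestComponentMissesOnlyIsolated (SimpleGraph.fromEdgeSet s)}
  have hP : ∀ N, P N {ω | LargestComponentMissesOnlyIsolated (B N ω)} =
      setBernoulli (cube N).edgeSet β (Q N) := by
    intro N
    have h := (hB N).measure_eq (p := fun s => s ∈ Q N) (Set.toFinite _).measurableSet
    simpa [Q] using h
  unfold WithHighProbability
  simp_rw [hP]
  have hlim : Tendsto (fun N => (setBernoulli (cube N).edgeSet β).real (Q N)ᶜ) atTop (𝓝 0) := by
    refine tendsto_of_tendsto_of_tendsto_of_le_of_le' tendsto_const_nhds tendsto_union_bound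
      (Eventually.of_forall fun N => measureReal_nonneg) ?_
    filter_upwards [eventually_ge_atTop 64] with N hN
    refine le_trans ?_ (measureReal_not_wellConnected_le hβ N)
    refine ENNReal.toReal_mono (measure_ne_top _ _) (measure_mono_ae ?_)
    filter_upwards [setBernoulli_ae_subset] with s hs hQ hw
    refine hQ (hw.largestComponent ?_ hN)
    rw [← SimpleGraph.fromEdgeSet_edgeSet (cube N)]
    exact SimpleGraph.fromEdgeSet_mono hs
  have h1 : ∀ N, setBernoulli (cube N).edgeSet β (Q N) =
      ENNReal.ofReal (1 - (setBernoulli (cube N).edgeSet β).real (Q N)ᶜ) := by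
    intro N
    rw [probReal_compl_eq_one_sub (Set.toFinite _).measurableSet, sub_sub_cancel, ofReal_measureReal]
  simp_rw [h1]
  have := (ENNReal.continuous_ofReal.tendsto _).comp (hlim.const_sub 1)
  simpa [Function.comp_def] using this

section Exploration

variable {N : ℕ} {z : Fin N → Profile N → ℝ} {a : Profile N} {X B : SimpleGraph (Profile N)}

lemma Toward.cube_adj {s t : Profile N} (h : Toward z s t) : (cube N).Adj s t :=
  h.imp fun _ h => h.1

lemma toward_flipAt_iff {i : Fin N} {u : Profile N} :
    Toward z u (flipAt i u) ↔ z i u < z i (flipAt i u) := by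
  simp only [Toward, neighborsAt_iff, flipAt_left_inj]
  exact ⟨fun ⟨j, hj, h⟩ => hj ▸ h, fun h => ⟨i, rfl, h⟩⟩

lemma monotone_explored : Monotone (explored z a) :=
  monotone_nat_of_le_succ fun _ => Set.subset_union_left

/-- The vertices at distance at most `k` from `a` in `X`. -/
def openBall (X : SimpleGraph (Profile N)) (a : Profile N) : ℕ → Set (Profile N)
  | 0 => {a}
  | k + 1 => openBall X a k ∪ {w | ∃ u ∈ openBall X a k, X.Adj u w}

lemma monotone_openBall : Monotone (openBall X a) :=
  monotone_nat_of_le_succ fun _ => Set.subset_union_left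

lemma not_leaves_symm_of_monotone {R : ℕ → Set (Profile N)} (hR : Monotone R) {u w : Profile N}
    {j k : ℕ} (h : Leaves (R j) u w) : ¬ Leaves (R k) w u := fun h' => by
  rcases le_total j k with hjk | hjk
  · exact h'.2.2 (hR hjk h.2.1)
  · exact h.2.2 (hR hjk h'.2.1)

lemma stage_adj_iff (k : ℕ) (u w : Profile N) : (stage z a B k).Adj u w ↔
    (∃ j < k, Leaves (explored z a j) u w) ∧ Toward z u w ∨
    (∃ j < k, Leaves (explored z a j) w u) ∧ Toward z w u ∨
    (¬ ∃ j < k, Leaves (explored z a j) u w) ∧ (¬ ∃ j < k, Leaves (explored z a j) w u) ∧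
      B.Adj u w := by
  induction k with
  | zero => simp [stage]
  | succ k ih =>
    have hs : ∀ x y, (∃ j < k + 1, Leaves (explored z a j) x y) ↔
        (∃ j < k, Leaves (explored z a j) x y) ∨ Leaves (explored z a k) x y := fun x y => by
      simp only [Nat.lt_succ_iff_lt_or_eq, or_and_right, exists_or, exists_eq_left]
    have h1 : Leaves (explored z a k) u w → ¬ ∃ j < k, Leaves (explored z a j) w u :=
      fun h ⟨_, _, h'⟩ => not_leaves_symm_of_monotone monotone_explored h h'
    have h2 : Leaves (explored z a k) w u → ¬ ∃ j < k, Leaves (explored z a j) u w :=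
      fun h ⟨_, _, h'⟩ => not_leaves_symm_of_monotone monotone_explored h h'
    have h3 : Leaves (explored z a k) u w → ¬ Leaves (explored z a k) w u :=
      not_leaves_symm_of_monotone monotone_explored
    have h4 : (∃ j < k, Leaves (explored z a j) u w) →
        ¬ ∃ j < k, Leaves (explored z a j) w u :=
      fun ⟨_, _, h⟩ ⟨_, _, h'⟩ => not_leaves_symm_of_monotone monotone_explored h h'
    rw [hs, hs]
    change ((Leaves (explored z a k) u w ∧ Toward z u w) ∨
      (Leaves (explored z a k) w u ∧ Toward z w u) ∨
      (¬ Leaves (explored z a k) u w ∧ ¬ Leaves (explored z a k) w u ∧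
        (stage z a B k).Adj u w)) ↔ _
    rw [ih]
    clear ih hs
    generalize (∃ j < k, Leaves (explored z a j) u w) = p₁ at *
    generalize (∃ j < k, Leaves (explored z a j) w u) = p₂ at *
    tauto

lemma explored_eq_openBall (hX : X ≤ cube N) {K : ℕ}
    (H : ∀ k < K, explored z a k = openBall X a k → ∀ u w, Leaves (openBall X a k) u w →
      (Toward z u w ↔ X.Adj u w)) {k : ℕ} (hk : k ≤ K) : explored z a k = openBall X a k := by
  induction k with
  | zero => rfl
  | succ k ih =>
    have ih := ih (by omega)
    have H := H k (by omega) ih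
    ext w
    simp only [explored, openBall, ih, Set.mem_union, Set.mem_ofPred_eq]
    by_cases hw : w ∈ openBall X a k
    · simp [hw]
    · simp only [hw, false_or, not_false_eq_true, true_and]
      refine exists_congr fun u => and_congr_right fun hu => ⟨fun h => ?_, fun h => ?_⟩
      · exact (H u w ⟨h.cube_adj, hu, hw⟩).1 h
      · exact (H u w ⟨hX h, hu, hw⟩).2 h

/-- The updated graph equals `X` iff the orientations match `X` on the edges that are explored
when `X` is explored, and the initial graph matches `X` on the other edges. -/
lemma stage_eq_iff (hX : X ≤ cube N) (K : ℕ) : stage z a B K = X ↔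
    (∀ u w, (∃ k < K, Leaves (openBall X a k) u w) → (Toward z u w ↔ X.Adj u w)) ∧
    ∀ u w, (¬ ∃ k < K, Leaves (openBall X a k) u w) → (¬ ∃ k < K, Leaves (openBall X a k) w u) →
      (B.Adj u w ↔ X.Adj u w) := by
  constructor
  · intro h
    have hadj : ∀ u w, _ := fun u w => h ▸ stage_adj_iff (z := z) (a := a) (B := B) K u w
    have key : ∀ k < K, ∀ u w, Leaves (explored z a k) u w → (Toward z u w ↔ X.Adj u w) := by
      intro k hk u w hl
      have h2 : ¬ ∃ j < K, Leaves (explored z a j) w u :=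
        fun ⟨_, _, h'⟩ => not_leaves_symm_of_monotone monotone_explored hl h'
      have h1 : ∃ j < K, Leaves (explored z a j) u w := ⟨k, hk, hl⟩
      rw [hadj]
      simp only [h1, h2, true_and, false_and, not_true_eq_false, or_false]
    have heq : ∀ k ≤ K, explored z a k = openBall X a k := fun k hk =>
      explored_eq_openBall hX (fun j hj hj' u w hl => key j hj u w (hj' ▸ hl)) hk
    refine ⟨fun u w ⟨k, hk, hl⟩ => key k hk u w ((heq k hk.le).symm ▸ hl), fun u w h1 h2 => ?_⟩
    have hs : ∀ x y, (∃ j < K, Leaves (explored z a j) x y) ↔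
        ∃ j < K, Leaves (openBall X a j) x y := fun x y =>
      exists_congr fun j => and_congr_right fun hj => by rw [heq j hj.le]
    rw [hadj, hs, hs]
    simp only [h1, h2, false_and, not_false_eq_true, true_and, false_or]
  · rintro ⟨h1, h2⟩
    have heq : ∀ k ≤ K, explored z a k = openBall X a k := fun k hk =>
      explored_eq_openBall hX (fun j hj _ u w hl => h1 u w ⟨j, hj, hl⟩) hk
    have hs : ∀ x y, (∃ j < K, Leaves (explored z a j) x y) ↔
        ∃ j < K, Leaves (openBall X a j) x y := fun x y =>
      exists_congr fun j => and_congr_right fun hj => by rw [heq j hj.le]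
    ext u w
    have h3 : (∃ k < K, Leaves (openBall X a k) u w) → ¬ ∃ k < K, Leaves (openBall X a k) w u :=
      fun ⟨_, _, h⟩ ⟨_, _, h'⟩ => not_leaves_symm_of_monotone monotone_openBall h h'
    have e1 := h1 u w
    have e2 := h1 w u
    have e3 := h2 u w
    rw [SimpleGraph.adj_comm X w u] at e2
    rw [stage_adj_iff, hs, hs]
    clear hs
    generalize (∃ j < K, Leaves (openBall X a j) u w) = p₁ at *
    generalize (∃ j < K, Leaves (openBall X a j) w u) = p₂ at *
    tauto

lemma stage_le_cube (hB : B ≤ cube N) (k : ℕ) : stage z a B k ≤ cube N := by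
  intro u w h
  rw [stage_adj_iff] at h
  rcases h with h | h | h
  · exact h.2.cube_adj
  · exact h.2.cube_adj.symm
  · exact hB h.2.2

end Exploration

section Law

variable {N : ℕ}

/-- The edge set of the updated graph, as a function of the payoffs and of the initial edge set. -/
def finalEdgeSet (a : Profile N) (x : (Fin N × Profile N → ℝ) × Set (Sym2 (Profile N))) :
    Set (Sym2 (Profile N)) :=
  (finalStage (fun i s => x.1 (i, s)) a (SimpleGraph.fromEdgeSet x.2)).edgeSet

lemma measurable_toward (u w : Profile N) :
    Measurable fun x : (Fin N × Profile N → ℝ) × Set (Sym2 (Profile N)) =>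
      Toward (fun i s => x.1 (i, s)) u w := by
  unfold Toward
  refine Measurable.exists fun i => Measurable.and measurable_const ?_
  refine measurableSet_setOfPred.1 (measurableSet_lt ?_ ?_) <;> fun_prop

lemma measurable_mem_explored (a : Profile N) (k : ℕ) (w : Profile N) :
    Measurable fun x : (Fin N × Profile N → ℝ) × Set (Sym2 (Profile N)) =>
      w ∈ explored (fun i s => x.1 (i, s)) a k := by
  induction k generalizing w with
  | zero => exact measurable_const
  | succ k ih =>
    exact (ih w).or ((ih w).not.and (Measurable.exists fun u => (ih u).and (measurable_toward u w)))

lemma measurable_finalEdgeSet (a : Profile N) : Measurable (finalEdgeSet a) := by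
  rw [measurable_set_iff]
  intro e
  induction e using Sym2.ind with | _ u w
  have hl : ∀ k u w, Measurable fun x : (Fin N × Profile N → ℝ) × Set (Sym2 (Profile N)) =>
      Leaves (explored (fun i s => x.1 (i, s)) a k) u w := fun k u w =>
    measurable_const.and ((measurable_mem_explored a k u).and (measurable_mem_explored a k w).not)
  have hl' : ∀ K u w, Measurable fun x : (Fin N × Profile N → ℝ) × Set (Sym2 (Profile N)) =>
      ∃ k < K, Leaves (explored (fun i s => x.1 (i, s)) a k) u w := fun K u w =>
    Measurable.exists fun k => measurable_const.and (hl k u w)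
  have hB : Measurable fun x : (Fin N × Profile N → ℝ) × Set (Sym2 (Profile N)) =>
      (SimpleGraph.fromEdgeSet x.2).Adj u w := by
    simp only [SimpleGraph.fromEdgeSet_adj]
    exact ((measurable_set_mem _).comp measurable_snd).and measurable_const
  simp only [finalEdgeSet, SimpleGraph.mem_edgeSet, finalStage, stage_adj_iff]
  exact ((hl' _ _ _).and (measurable_toward _ _)).or (((hl' _ _ _).and (measurable_toward _ _)).or
    ((hl' _ _ _).not.and ((hl' _ _ _).not.and hB)))

variable {β : unitInterval} {μ : Measure ℝ} [IsProbabilityMeasure μ]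

lemma measureReal_pi_lt_iff {ι : Type*} [Fintype ι] (hβ : (μ.prod μ).real {x | x.1 < x.2} = 1 / 2)
    {i j : ι} (hij : i ≠ j) (q : Prop) :
    (Measure.pi fun _ : ι => μ).real {z | z i < z j ↔ q} = 1 / 2 := by
  have hlaw : HasLaw (fun z : ι → ℝ => (z i, z j)) (μ.prod μ) (Measure.pi fun _ : ι => μ) :=
    IndepFun.hasLaw_prod (measurePreserving_eval (fun _ : ι => μ) i).hasLaw
      (measurePreserving_eval (fun _ : ι => μ) j).hasLaw
      ((iIndepFun_pi (μ := fun _ : ι => μ) (X := fun _ => id) fun _ => aemeasurable_id).indepFun hij)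
  have hm : MeasurableSet {x : ℝ × ℝ | x.1 < x.2} := measurableSet_lt measurable_fst measurable_snd
  have h := hlaw.measureReal_eq (p := fun x => x.1 < x.2) hm
  by_cases hq : q
  · simp only [hq, iff_true]
    rw [h, hβ]
  · simp only [hq, iff_false]
    have hc : {z : ι → ℝ | ¬ z i < z j} = {z | z i < z j}ᶜ := rfl
    rw [hc, probReal_compl_eq_one_sub (measurableSet_lt (measurable_pi_apply i)
      (measurable_pi_apply j)), h, hβ]
    norm_num

/-- Comparisons of payoffs at disjoint pairs are independent fair coins. -/
lemma measureReal_pi_forall_lt_iff {ι κ : Type*} [Fintype ι]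
    (hβ : (μ.prod μ).real {x | x.1 < x.2} = 1 / 2) (D : Finset κ) {f g : κ → ι}
    (hfg : ∀ k, f k ≠ g k) (hd : (D : Set κ).PairwiseDisjoint fun k => ({f k, g k} : Set ι))
    (q : κ → Prop) : (Measure.pi fun _ : ι => μ).real
      {z | ∀ k ∈ D, (z (f k) < z (g k) ↔ q k)} = (1 / 2) ^ D.card := by
  have hm : ∀ k ∈ D, MeasurableSet[⨆ i ∈ ({f k, g k} : Set ι), MeasurableSpace.comap
      (fun z : ι → ℝ => z i) inferInstance] {z | z (f k) < z (g k) ↔ q k} := by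
    intro k _
    set m := ⨆ i ∈ ({f k, g k} : Set ι), MeasurableSpace.comap
      (fun z : ι → ℝ => z i) inferInstance
    have h1 : ∀ i ∈ ({f k, g k} : Set ι), Measurable[m] fun z : ι → ℝ => z i := fun i hi =>
      measurable_iff_comap_le.2 (le_iSup₂_of_le i hi le_rfl)
    have h2 : MeasurableSet[m] {z : ι → ℝ | z (f k) < z (g k)} :=
      @measurableSet_lt _ _ _ _ _ m _ _ _ _ _ (h1 _ (by simp)) (h1 _ (by simp))
    by_cases hq : q k
    · simpa only [hq, iff_true] using h2
    · simpa only [hq, iff_false] using! h2.compl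
  have h := iIndep.measure_biInter_of_pairwiseDisjoint (μ := Measure.pi fun _ : ι => μ)
    (fun i => (measurable_pi_apply i).comap_le)
    (iIndepFun_pi (μ := fun _ : ι => μ) (X := fun _ => id) fun _ => aemeasurable_id).iIndep D hd hm
  have h2 : {z : ι → ℝ | ∀ k ∈ D, (z (f k) < z (g k) ↔ q k)} =
      ⋂ k ∈ D, {z | z (f k) < z (g k) ↔ q k} := by ext; simp
  rw [h2, measureReal_def, h, ENNReal.toReal_prod, ← Finset.prod_const]
  exact Finset.prod_congr rfl fun k _ => measureReal_pi_lt_iff hβ (hfg k) _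

open Classical in
lemma measureReal_finalEdgeSet_eq (hβ : (β : ℝ) = 1 / 2)
    (hμ : (μ.prod μ).real {x | x.1 < x.2} = 1 / 2) (a : Profile N) {T : Set (Sym2 (Profile N))}
    (hT : T ⊆ (cube N).edgeSet) :
    ((Measure.pi fun _ : Fin N × Profile N => μ).prod (setBernoulli (cube N).edgeSet β)).real
      {x | finalEdgeSet a x = T} = (1 / 2) ^ (cube N).edgeSet.ncard := by
  set X := SimpleGraph.fromEdgeSet T with hXdef
  have hXT : X.edgeSet = T := by
    rw [hXdef, SimpleGraph.edgeSet_fromEdgeSet]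
    exact sdiff_eq_left.2 (Set.disjoint_left.2 fun e he =>
      SimpleGraph.not_isDiag_of_mem_edgeSet _ (hT he))
  have hX : X ≤ cube N := by rw [← SimpleGraph.edgeSet_subset_edgeSet, hXT]; exact hT
  set K := 2 ^ N - 1
  set E := (cube N).edgeSet.toFinset with hE
  set D := E.filter fun e => ∃ i u, e = s(u, flipAt i u) ∧
    ∃ k < K, Leaves (openBall X a k) u (flipAt i u) with hD
  have hch : ∀ e : D, ∃ i u, e.1 = s(u, flipAt i u) ∧
    ∃ k < K, Leaves (openBall X a k) u (flipAt i u) := fun e => (Finset.mem_filter.1 e.2).2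
  choose dir tail hedge hleaves using hch
  have hmemD : ∀ u w, (∃ k < K, Leaves (openBall X a k) u w) → s(u, w) ∈ D := by
    rintro u w ⟨k, hk, hl⟩
    obtain ⟨i, rfl⟩ := cube_adj_iff.1 hl.1
    exact Finset.mem_filter.2 ⟨by simpa [hE] using hl.1, i, u, rfl, k, hk, hl⟩
  have htail : ∀ u w (h : ∃ k < K, Leaves (openBall X a k) u w),
      tail ⟨s(u, w), hmemD u w h⟩ = u ∧
        flipAt (dir ⟨s(u, w), hmemD u w h⟩) (tail ⟨s(u, w), hmemD u w h⟩) = w := by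
    intro u w h
    have h1 := hedge ⟨s(u, w), hmemD u w h⟩
    obtain ⟨k', _, hl'⟩ := hleaves ⟨s(u, w), hmemD u w h⟩
    rcases Sym2.eq_iff.1 h1 with ⟨h1, h2⟩ | ⟨h1, h2⟩
    · exact ⟨h1.symm, h2.symm⟩
    · obtain ⟨k, _, hl⟩ := h
      rw [← h1, ← h2] at hl'
      exact absurd hl' (not_leaves_symm_of_monotone monotone_openBall hl)
  set f : D → Fin N × Profile N := fun e => (dir e, tail e) with hf
  set g : D → Fin N × Profile N := fun e => (dir e, flipAt (dir e) (tail e)) with hg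
  have hevent : ∀ (x : (Fin N × Profile N → ℝ) × Set (Sym2 (Profile N))),
      x.2 ⊆ (cube N).edgeSet → (finalEdgeSet a x = T ↔
        x.1 ∈ {z | ∀ e ∈ (Finset.univ : Finset D), (z (f e) < z (g e) ↔ e.1 ∈ T)} ∧
        x.2 ∈ {s | ∀ e ∈ E \ D, (e ∈ s ↔ e ∈ T)}) := by
    rintro ⟨z, s⟩ hs
    have h0 : finalEdgeSet a (z, s) = T ↔
        stage (fun i t => z (i, t)) a (SimpleGraph.fromEdgeSet s) K = X := by
      rw [← SimpleGraph.edgeSet_inj, hXT]; rfl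
    have hTX : ∀ u w, s(u, w) ∈ T ↔ X.Adj u w := fun u w => by
      rw [← SimpleGraph.mem_edgeSet, hXT]
    rw [h0, stage_eq_iff hX]
    refine and_congr ⟨fun h e _ => ?_, fun h u w hl => ?_⟩ ⟨fun h e he => ?_, fun h u w h1 h2 => ?_⟩
    · have h1 := h _ _ (hleaves e)
      rw [toward_flipAt_iff] at h1
      rw [hedge e, hTX]
      exact h1
    · have h1 := h ⟨s(u, w), hmemD u w hl⟩ (Finset.mem_univ _)
      obtain ⟨e1, e2⟩ := htail u w hl
      simp only [hf, hg, e1, hTX] at h1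
      rw [e1] at e2
      rw [e2] at h1
      have h2 := toward_flipAt_iff (z := fun i t => z (i, t)) (i := dir ⟨s(u, w), hmemD u w hl⟩)
        (u := u)
      rw [e2] at h2
      exact h2.trans h1
    · rw [Finset.mem_sdiff] at he
      induction e using Sym2.ind with | _ u w
      have h1 := h u w (fun h' => he.2 (hmemD u w h'))
        (fun h' => he.2 (Sym2.eq_swap ▸ hmemD w u h'))
      rw [hTX, ← h1, SimpleGraph.fromEdgeSet_adj]
      have : u ≠ w := (SimpleGraph.mem_edgeSet _ |>.1 (by simpa [hE] using he.1) :
        (cube N).Adj u w).ne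
      simp [this]
    · by_cases hcube : (cube N).Adj u w
      · have hnD : s(u, w) ∉ D := by
          intro hmem
          obtain ⟨_, i, t, het, k, hk, hl⟩ := Finset.mem_filter.1 hmem
          rcases Sym2.eq_iff.1 het with ⟨e1, e2⟩ | ⟨e1, e2⟩
          · exact h1 ⟨k, hk, by rw [e1, e2]; exact hl⟩
          · exact h2 ⟨k, hk, by rw [e1, e2]; exact hl⟩
        have h3 := h s(u, w) (Finset.mem_sdiff.2 ⟨by simpa [hE] using hcube, hnD⟩)
        rw [← hTX, ← h3, SimpleGraph.fromEdgeSet_adj]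
        simp [hcube.ne]
      · refine iff_of_false (fun h' => hcube ?_) fun h' => hcube (hX h')
        exact hs ((SimpleGraph.fromEdgeSet_adj _).1 h').1
  set A := {z : Fin N × Profile N → ℝ |
    ∀ e ∈ (Finset.univ : Finset D), (z (f e) < z (g e) ↔ e.1 ∈ T)}
  set C := {s : Set (Sym2 (Profile N)) | ∀ e ∈ E \ D, (e ∈ s ↔ e ∈ T)}
  have hae : {x | finalEdgeSet a x = T} =ᵐ[(Measure.pi fun _ : Fin N × Profile N => μ).prod
      (setBernoulli (cube N).edgeSet β)] A ×ˢ C := by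
    have h1 : ∀ᵐ x ∂(Measure.pi fun _ : Fin N × Profile N => μ).prod
        (setBernoulli (cube N).edgeSet β), x.2 ⊆ (cube N).edgeSet :=
      Measure.quasiMeasurePreserving_snd.ae setBernoulli_ae_subset
    filter_upwards [h1] with x hx
    exact propext (hevent x hx)
  have hA : (Measure.pi fun _ : Fin N × Profile N => μ).real A = (1 / 2) ^ D.card := by
    have h := measureReal_pi_forall_lt_iff hμ (Finset.univ : Finset D) (f := f) (g := g)
      (fun e h => (flipAt_ne (dir e) (tail e)) (Prod.ext_iff.1 h).2.symm) ?_ fun e => e.1 ∈ T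
    · rwa [Finset.card_univ, Fintype.card_coe] at h
    · intro e _ e' _ hne
      simp only [Function.onFun, Set.disjoint_left]
      intro x hx hx'
      have key : ∀ e : D, x ∈ ({f e, g e} : Set (Fin N × Profile N)) →
          e.1 = s(x.2, flipAt x.1 x.2) := by
        rintro e (rfl | rfl)
        · exact hedge e
        · simp only [hg, flipAt_flipAt]
          rw [Sym2.eq_swap]
          exact hedge e
      exact hne (Subtype.ext ((key e hx).trans (key e' hx').symm))
  have hC : (setBernoulli (cube N).edgeSet β).real C = (1 / 2) ^ (E \ D).card :=
    setBernoulli_real_pattern hβ (fun e he => by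
      have := (Finset.mem_sdiff.1 (Finset.mem_coe.1 he)).1
      simpa [hE] using this) T
  rw [measureReal_congr hae, measureReal_prod_prod, hA, hC, ← pow_add,
    Finset.card_sdiff_of_subset (Finset.filter_subset _ _),
    Nat.add_sub_cancel' (Finset.card_le_card (Finset.filter_subset _ _)),
    Set.ncard_eq_toFinset_card']

lemma hasLaw_finalEdgeSet (hβ : (β : ℝ) = 1 / 2)
    (hμ : (μ.prod μ).real {x | x.1 < x.2} = 1 / 2) (a : Profile N) :
    HasLaw (finalEdgeSet a) (setBernoulli (cube N).edgeSet β)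
      ((Measure.pi fun _ : Fin N × Profile N => μ).prod (setBernoulli (cube N).edgeSet β)) := by
  refine ⟨(measurable_finalEdgeSet a).aemeasurable, ?_⟩
  have := Measure.isProbabilityMeasure_map (μ := (Measure.pi fun _ : Fin N × Profile N => μ).prod
    (setBernoulli (cube N).edgeSet β)) (measurable_finalEdgeSet a).aemeasurable
  refine Measure.ext_of_measureReal_singleton fun T => ?_
  rw [map_measureReal_apply (measurable_finalEdgeSet a) (by simp)]
  change Measure.real _ {x | finalEdgeSet a x = T} = _
  by_cases hT : T ⊆ (cube N).edgeSet
  · rw [measureReal_finalEdgeSet_eq hβ hμ a hT, setBernoulli_real_singleton _ hT (Set.toFinite _),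
      hβ, show (1 - 1 / 2 : ℝ) = 1 / 2 by norm_num, ← pow_add, add_comm,
      Set.ncard_sdiff_add_ncard_of_subset hT]
  · rw [measureReal_def, measureReal_def, setBernoulli_singleton_of_not_subset _ hT]
    congr 1
    have h1 : ∀ᵐ x ∂(Measure.pi fun _ : Fin N × Profile N => μ).prod
        (setBernoulli (cube N).edgeSet β), x.2 ⊆ (cube N).edgeSet :=
      Measure.quasiMeasurePreserving_snd.ae setBernoulli_ae_subset
    have h2 : ((Measure.pi fun _ : Fin N × Profile N => μ).prod (setBernoulli (cube N).edgeSet β))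
        {x | ¬ x.2 ⊆ (cube N).edgeSet} = 0 := h1
    refine measure_mono_null (fun x (hx : finalEdgeSet a x = T) => ?_) h2
    refine fun hs : x.2 ⊆ (cube N).edgeSet => hT ?_
    rw [← hx]
    refine SimpleGraph.edgeSet_mono (stage_le_cube ?_ _)
    rw [← SimpleGraph.fromEdgeSet_edgeSet (cube N)]
    exact SimpleGraph.fromEdgeSet_mono hs

end Law

/-- The graph updated along the exploration is again a bond percolation. -/
lemma isBondPercolation_finalStage {N : ℕ} {Ω : Type*} [MeasurableSpace Ω] {P : Measure Ω}
    [IsProbabilityMeasure P] {β : unitInterval} (hβ : (β : ℝ) = 1 / 2) {μ : Measure ℝ}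
    [IsProbabilityMeasure μ] {Z : Fin N → Profile N → Ω → ℝ} {B : Ω → SimpleGraph (Profile N)}
    (a : Profile N) (hμ : (μ.prod μ).real {x | x.1 < x.2} = β) (hZ : ∀ i s, HasLaw (Z i s) μ P)
    (hind : iIndepFun (fun e : Fin N × Profile N => Z e.1 e.2) P)
    (hB : IsBondPercolation (cube N) β B P)
    (hZB : IndepFun (fun ω (e : Fin N × Profile N) => Z e.1 e.2 ω) (fun ω => (B ω).edgeSet) P) :
    IsBondPercolation (cube N) β (fun ω => finalStage (fun i s => Z i s ω) a (B ω)) P := by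
  have h := HasLaw.comp (hasLaw_finalEdgeSet hβ (hμ.trans hβ) a)
    (hZB.hasLaw_prod (iIndepFun.hasLaw_pi (fun e : Fin N × Profile N => hZ e.1 e.2) hind) hB)
  simpa [IsBondPercolation, finalEdgeSet, Function.comp_def] using h

end NCube

theorem mainTheorem6 (β : unitInterval) (hβ : (β : ℝ) = 1 / 2) :
    -- every bond percolation on the cubes with parameter `β`
    (∀ (Ω : ℕ → Type*) [∀ N, MeasurableSpace (Ω N)] (P : ∀ N, Measure (Ω N))
      [∀ N, IsProbabilityMeasure (P N)] (B : ∀ N, Ω N → SimpleGraph (NCube.Profile N)),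
      (∀ N, NCube.IsBondPercolation (NCube.cube N) β (B N) (P N)) →
      NCube.WithHighProbability P
        (fun N => {ω | NCube.LargestComponentMissesOnlyIsolated (B N ω)})) ∧
    -- in particular the percolation that is coupled with a game with i.i.d. payoffs
    (∀ (Ω : ℕ → Type*) [∀ N, MeasurableSpace (Ω N)] (P : ∀ N, Measure (Ω N))
      [∀ N, IsProbabilityMeasure (P N)]
      (μ : Measure ℝ) [IsProbabilityMeasure μ]
      (Z : ∀ N, Fin N → NCube.Profile N → Ω N → ℝ)
      (B₁ : ∀ N, Ω N → SimpleGraph (NCube.Profile N))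
      (a : ∀ N, NCube.Profile N),
      (μ.prod μ).real {x | x.1 < x.2} = β →
      (∀ N i s, HasLaw (Z N i s) μ (P N)) →
      (∀ N, iIndepFun (fun (e : Fin N × NCube.Profile N) => Z N e.1 e.2) (P N)) →
      (∀ N, NCube.IsBondPercolation (NCube.cube N) β (B₁ N) (P N)) →
      (∀ N, IndepFun (fun ω (e : Fin N × NCube.Profile N) => Z N e.1 e.2 ω)
        (fun ω => (B₁ N ω).edgeSet) (P N)) →
      NCube.WithHighProbability P
        (fun N => {ω | NCube.LargestComponentMissesOnlyIsolated
          (NCube.finalStage (fun i s => Z N i s ω) (a N) (B₁ N ω))})) := by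
  refine ⟨fun Ω _ P _ B hB => NCube.withHighProbability_of_isBondPercolation hβ hB,
    fun Ω _ P _ μ _ Z B₁ a hμ hZ hind hB hZB => ?_⟩
  exact NCube.withHighProbability_of_isBondPercolation hβ fun N =>
    NCube.isBondPercolation_finalStage hβ (a N) hμ (hZ N) (hind N) (hB N) (hZB N)
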